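/- Let $e\ge 0$ be an integer and let $X_e=\mathbb P(\mathcal O\oplus\mathcal O(-e))\to\mathbb{CP}^1$ be the $e$-th Hirzebruch surface. Let $L$ be a fibre and $M_0$ the special section, so that $L^2=0$, $M_0^2=-e$, $L\cdot M_0=1$, and put $M=eL+M_0$. For integers $a\ge 0$ and $b>0$ ($b\ge 0$ when $e=0$), a curve $C\subset X_e$ is said to be of type $(a,b)$ if it is irreducible and its homology class is $aL+bM\in H_2(X_e;\mathbb Z)$. Let $C\subset X_e$ be a curve of type $(a,b)$ (not necessarily rational or cuspidal), and let $r$ be the multiplicity of a singular point of $C$. Then $r\le b$. -/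

import Mathlib

open scoped LinearAlgebra.Projectivization Topology

noncomputable section

namespace Hirzebruch

/-! ### The surface -/

/-- Homogeneous coordinates: a pair of nonzero vectors `x = (x₀, x₁)`, `y = (y₀, y₁)`. -/
abbrev Coord : Type :=
  {v : Fin 2 → ℂ // v ≠ 0} × {v : Fin 2 → ℂ // v ≠ 0}

/-- `(x₀, x₁, y₀, y₁) ∼ (c x₀, c x₁, d y₀, d c⁻ᵉ y₁)` for `c, d ∈ ℂˣ`. -/
def Rel (e : ℕ) (z w : Coord) : Prop :=
  ∃ c d : ℂˣ, (∀ k, w.1.1 k = c * z.1.1 k) ∧ w.2.1 0 = d * z.2.1 0 ∧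
    w.2.1 1 = d * ((c⁻¹ ^ e : ℂˣ) : ℂ) * z.2.1 1

theorem rel_equivalence (e : ℕ) : Equivalence (Rel e) where
  refl z := ⟨1, 1, by simp⟩
  symm := by
    rintro z w ⟨c, d, h1, h2, h3⟩
    refine ⟨c⁻¹, d⁻¹, fun k => by simp [h1], by simp [h2], ?_⟩
    rw [h3]
    have hc : (c : ℂ) ≠ 0 := c.ne_zero
    have hd : (d : ℂ) ≠ 0 := d.ne_zero
    simp only [Units.val_pow_eq_pow_val, Units.val_inv_eq_inv_val, inv_inv, inv_pow]
    field_simp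
  trans := by
    rintro z w u ⟨c, d, h1, h2, h3⟩ ⟨c', d', h1', h2', h3'⟩
    refine ⟨c' * c, d' * d, fun k => ?_, ?_, ?_⟩
    · rw [h1', h1]; push_cast; ring
    · rw [h2', h2]; push_cast; ring
    · rw [h3', h3]
      simp only [mul_inv, mul_pow, Units.val_mul]
      ring

/-- The equivalence relation of homogeneous coordinates. -/
def setoid (e : ℕ) : Setoid Coord := ⟨Rel e, rel_equivalence e⟩

/-- The Hirzebruch surface `Xₑ = ℙ(𝒪 ⊕ 𝒪(-e))` over `ℂℙ¹`, in homogeneous coordinates: the fibre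
of `𝒪(-e)` over the line `ℓ ⊆ ℂ²` is `ℓ^{⊗ e}`, and the class of `(x, y)` is the line spanned by
`(y₀, y₁ x^{⊗ e})` in `ℂ ⊕ ℓ^{⊗ e}`, where `ℓ = [x]`. -/
def Surface (e : ℕ) : Type := Quotient (setoid e)

/-- The classical topology: the quotient topology. -/
instance (e : ℕ) : TopologicalSpace (Surface e) :=
  inferInstanceAs (TopologicalSpace (Quotient (setoid e)))

/-- The point with given homogeneous coordinates. -/
def mk (e : ℕ) (z : Coord) : Surface e := Quotient.mk (setoid e) z

/-- The bundle projection `Xₑ → ℂℙ¹`. -/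
def proj (e : ℕ) : Surface e → ℙ ℂ (Fin 2 → ℂ) :=
  Quotient.lift (fun z : Coord => Projectivization.mk ℂ z.1.1 z.1.2) (by
    rintro z w ⟨c, -, h, -⟩
    refine ((Projectivization.mk_eq_mk_iff ℂ _ _ _ _).2 ⟨c, ?_⟩).symm
    ext k
    simp [h k, Units.smul_def])

/-- The fibre of `Xₑ` over a point of `ℂℙ¹`. -/
def fibre (e : ℕ) (ℓ : ℙ ℂ (Fin 2 → ℂ)) : Set (Surface e) := proj e ⁻¹' {ℓ}

/-- The special section `M₀ = {y₁ = 0}`, of self-intersection `-e`. -/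
def specialSection (e : ℕ) : Set (Surface e) := mk e '' {z | z.2.1 1 = 0}

/-- The vector whose `i`-th coordinate is `1` and whose other coordinate is `t`. -/
def affineVec (i : Fin 2) (t : ℂ) : {v : Fin 2 → ℂ // v ≠ 0} :=
  ⟨Function.update (fun _ => t) i 1, fun h => by simpa using congrFun h i⟩

/-- The four affine charts `ℂ² → Xₑ`: the chart `(i, j)` parametrises the points with `xᵢ ≠ 0`
and `yⱼ ≠ 0` by their representatives with `xᵢ = yⱼ = 1`. -/
def chart (e : ℕ) (i : Fin 2 × Fin 2) (p : Fin 2 → ℂ) : Surface e :=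
  mk e (affineVec i.1 (p 0), affineVec i.2 (p 1))

/-- The affine open sets that cover `Xₑ`. -/
def U (e : ℕ) (i : Fin 2 × Fin 2) : Set (Surface e) := Set.range (chart e i)

/-! ### Curves, singular points, multiplicities -/

/-- The Zariski topology: a set is open if its preimage under each chart `ℂ² → Xₑ` is Zariski open
in `ℂ²`. -/
@[reducible]
def zariski (e : ℕ) : TopologicalSpace (Surface e) :=
  ⨆ i, TopologicalSpace.coinduced (chart e i)
    (TopologicalSpace.induced (MvPolynomial.pointToPoint (k := ℂ)) inferInstance)

/-- `C` is an irreducible (algebraic) curve in `Xₑ`: Zariski closed, irreducible and of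
dimension one. -/
def IsIrreducibleCurve {e : ℕ} (C : Set (Surface e)) : Prop :=
  IsClosed[zariski e] C ∧ @IsIrreducible _ (zariski e) C ∧
    @topologicalKrullDim C (@instTopologicalSpaceSubtype _ _ (zariski e)) = 1

/-- The ideal in `ℂ[t, s]` of `C` in an affine chart. -/
def chartIdeal {e : ℕ} (C : Set (Surface e)) (i : Fin 2 × Fin 2) :
    Ideal (MvPolynomial (Fin 2) ℂ) :=
  MvPolynomial.vanishingIdeal ℂ (chart e i ⁻¹' C)

/-- `x` is a singular point of the curve `C`: it lies on `C`, and the differentials at `x` of all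
the local equations of `C` vanish. -/
def IsSingularPoint {e : ℕ} (C : Set (Surface e)) (x : Surface e) : Prop :=
  x ∈ C ∧ ∃ i p, chart e i p = x ∧
    ∀ f ∈ chartIdeal C i, ∀ k, MvPolynomial.eval p (MvPolynomial.pderiv k f) = 0

/-- The multiplicity of `C` at `x`: the largest `n` such that the local equations of `C` lie in the
`n`-th power of the maximal ideal of `x`, i.e. the order of the Taylor expansion at `x` of
the local equation of `C`. It does not depend on the chart. -/
def multiplicity {e : ℕ} (C : Set (Surface e)) (x : Surface e) : ℕ∞ :=
  ⨆ (i : Fin 2 × Fin 2) (p : Fin 2 → ℂ) (_ : chart e i p = x) (n : ℕ)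
    (_ : chartIdeal C i ≤ MvPolynomial.vanishingIdeal ℂ {p} ^ n), (n : ℕ∞)

/-! ### Homology classes

By Poincaré duality `H₂(Xₑ; ℤ) = H²(Xₑ; ℤ)`, and by the first Chern class `H²(Xₑ; ℤ)` is the
group of topological complex line bundles on `Xₑ`, i.e. the first cohomology of the sheaf of
continuous functions with values in `ℂˣ`. As the charts are contractible, all line bundles are
trivial on them, so this is the first cohomology of the Čech complex of the cover by charts.
Under these identifications the homology class of a curve `C` is the class of the line bundle
`𝒪(C)`, whose transition functions are the quotients `fᵢ / fⱼ` of local equations of `C`. -/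

/-- Čech `0`-cochains of nowhere vanishing continuous functions. -/
abbrev Cochain0 (e : ℕ) : Type := (i : Fin 2 × Fin 2) → C(U e i, ℂˣ)

/-- Čech `1`-cochains of nowhere vanishing continuous functions. -/
abbrev Cochain1 (e : ℕ) : Type :=
  (i j : Fin 2 × Fin 2) → C((U e i ∩ U e j : Set (Surface e)), ℂˣ)

/-- Čech `1`-cocycles: `gᵢⱼ gⱼₖ = gᵢₖ` on `Uᵢ ∩ Uⱼ ∩ Uₖ`. -/
def cocycles (e : ℕ) : Subgroup (Cochain1 e) where
  carrier := {g | ∀ i j k x (hi : x ∈ U e i) (hj : x ∈ U e j) (hk : x ∈ U e k),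
    g i j ⟨x, hi, hj⟩ * g j k ⟨x, hj, hk⟩ = g i k ⟨x, hi, hk⟩}
  one_mem' := by intro i j k x hi hj hk; simp
  mul_mem' := by
    intro g h hg hh i j k x hi hj hk
    simp only [Pi.mul_apply, ContinuousMap.mul_apply]
    rw [← hg i j k x hi hj hk, ← hh i j k x hi hj hk, mul_mul_mul_comm]
  inv_mem' := by
    intro g hg i j k x hi hj hk
    simp only [Pi.inv_apply, ContinuousMap.inv_apply]
    rw [← hg i j k x hi hj hk, mul_inv]

/-- The Čech differential `(hᵢ) ↦ (hᵢ / hⱼ)`. -/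
def differential (e : ℕ) : Cochain0 e →* cocycles e where
  toFun h :=
    ⟨fun i j => (h i).comp (ContinuousMap.inclusion Set.inter_subset_left) /
        (h j).comp (ContinuousMap.inclusion Set.inter_subset_right), by
      intro i j k x hi hj hk
      exact div_mul_div_cancel _ _ _⟩
  map_one' := by
    ext i j x
    simp
  map_mul' g h := by
    ext i j x
    simp [mul_div_mul_comm]

/-- The group `H₂(Xₑ; ℤ)`. -/
abbrev H2 (e : ℕ) : Type := Additive (cocycles e ⧸ (differential e).range)

/-- `γ` is the homology class of the curve `C`: there are local equations `fᵢ` of `C` in the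
charts, and a cocycle `g` representing `γ` with `fᵢ = gᵢⱼ fⱼ` on `Uᵢ ∩ Uⱼ`. -/
def IsClassOf {e : ℕ} (C : Set (Surface e)) (γ : H2 e) : Prop :=
  ∃ (f : Fin 2 × Fin 2 → MvPolynomial (Fin 2) ℂ) (g : cocycles e),
    (∀ i, chartIdeal C i = Ideal.span {f i}) ∧
    (∀ i j p q, ∀ h : chart e i p = chart e j q,
      MvPolynomial.eval p (f i) =
        (g.1 i j ⟨chart e i p, ⟨p, rfl⟩, ⟨q, h.symm⟩⟩ : ℂˣ) * MvPolynomial.eval q (f j)) ∧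
    γ = Additive.ofMul (QuotientGroup.mk g)

/-- `C` is a curve of type `(a, b)`: an irreducible curve whose homology class is `a L + b M`,
where `L` is the class of a fibre and `M = e L + M₀`. Here `b > 0`, or `b ≥ 0` if `e = 0`. -/
def IsOfType {e : ℕ} (C : Set (Surface e)) (a b : ℕ) : Prop :=
  (0 < b ∨ e = 0) ∧ IsIrreducibleCurve C ∧
    ∃ (ℓ : ℙ ℂ (Fin 2 → ℂ)) (γ L M₀ : H2 e),
      IsClassOf C γ ∧ IsClassOf (fibre e ℓ) L ∧ IsClassOf (specialSection e) M₀ ∧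
        γ = a • L + b • (e • L + M₀)

end Hirzebruch

end

namespace Hirzebruch

open Polynomial

/-! ### Degrees of clutching functions -/

/-! The bound is the intersection inequality `r ≤ C · L = b` for the fibre through the point.
Restrict a local equation of `C` to that fibre. If the restriction is nonzero, it is a polynomial in
one variable that vanishes to order at least `r` at the point
(`le_natDegree_restrictLine_of_mem_pow`) and has degree at most `b`. If it is zero, `C` contains the
line, hence lies in a fibre because it is irreducible of dimension one, and then it has no singular
points.

The degree bound is topological. On a fibre other than the one representing `L`, the equations of
that fibre are units and the equation of `M₀` has a simple zero at one point. The homology relation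
then makes the two restricted equations of `C` sections of a line bundle with clutching function `s
^ b` times factors that extend without zeros (`exists_clutching`). A winding number argument
(`eq_of_clutching`) counts the zeros of such a section on the projective line: there are `b`, so
each affine part has degree at most `b`. The remaining fibre follows since the coefficients of the
restriction are polynomials in the base coordinate. -/

theorem eq_of_exp_comp_eq_const {φ : ℝ → ℂ} (hφ : Continuous φ) {c : ℂ}
    (h : ∀ θ, Complex.exp (φ θ) = c) (x y : ℝ) : φ x = φ y := by
  have key := Complex.isCoveringMap_exp.eq_of_comp_eq (g₁ := φ) (g₂ := fun _ => φ y) hφ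
    continuous_const (by ext θ; simp [h]) y rfl
  exact congrFun key x

theorem isSimplyConnected_of_convex {s : Set ℂ} (hs : Convex ℝ s) (hne : s.Nonempty) :
    IsSimplyConnected s := by
  have := hs.contractibleSpace hne
  exact SimplyConnectedSpace.ofContractible s

/-- If `F` is continuous and nowhere zero near the origin, and `H` is continuous and nowhere zero on
the plane, then the clutching function `F(w) / H(w⁻¹)` has degree zero. -/
theorem eq_of_clutching {F H : ℂ → ℂ} {ρ : ℝ} (hρ : 0 < ρ)
    (hF : ContinuousOn F (Metric.ball 0 ρ)) (hF0 : ∀ w ∈ Metric.ball (0 : ℂ) ρ, F w ≠ 0)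
    (hH : Continuous H) (hH0 : ∀ w, H w ≠ 0) {b n : ℕ}
    (h : ∀ w ∈ Metric.ball (0 : ℂ) ρ, w ≠ 0 → F w * w ^ b = w ^ n * H w⁻¹) : b = n := by
  obtain ⟨f, hf, hfF⟩ := Complex.exists_continuousOn_eqOn_exp_comp
    (isSimplyConnected_of_convex (convex_ball (0 : ℂ) ρ) ⟨0, by simpa⟩) Metric.isOpen_ball hF
    (by rintro ⟨w, hw, h0⟩; exact hF0 w hw h0)
  obtain ⟨g, hg, hgH⟩ := Complex.exists_continuousOn_eqOn_exp_comp
    (isSimplyConnected_of_convex convex_univ ⟨0, trivial⟩) isOpen_univ hH.continuousOn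
    (by rintro ⟨w, hw, h0⟩; exact hH0 w h0)
  rw [continuousOn_univ] at hg
  set r : ℂ := ((ρ / 2 : ℝ) : ℂ) with hr
  have hr0 : r ≠ 0 := by
    rw [hr, Complex.ofReal_ne_zero]; positivity
  set z : ℝ → ℂ := fun θ => r * Complex.exp (θ * Complex.I) with hz
  have hzc : Continuous z := by fun_prop
  have hz0 : ∀ θ, z θ ≠ 0 := fun θ => mul_ne_zero hr0 (Complex.exp_ne_zero _)
  have hzb : ∀ θ, z θ ∈ Metric.ball (0 : ℂ) ρ := by
    intro θ
    simp only [hz, hr, mem_ball_zero_iff, norm_mul, Complex.norm_exp_ofReal_mul_I,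
      Complex.norm_real, Real.norm_eq_abs, mul_one]
    rw [abs_of_pos (by positivity)]
    linarith
  -- A continuous logarithm, along the circle of radius `ρ / 2`, of a quantity that `h` forces to be
  -- constant. After one turn only its linear term has changed, by `(b - n) * 2πi`.
  set φ : ℝ → ℂ := fun θ => f (z θ) - g (z θ)⁻¹ + ((b : ℂ) - n) * (θ * Complex.I) with hφ
  have hφc : Continuous φ := by
    have h1 : Continuous fun θ => f (z θ) := hf.comp_continuous hzc hzb
    have h2 : Continuous fun θ => g (z θ)⁻¹ := hg.comp (hzc.inv₀ hz0)
    exact (h1.sub h2).add (by fun_prop)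
  have hexp : ∀ θ, Complex.exp (φ θ) = r ^ n / r ^ b := by
    intro θ
    have h1 : Complex.exp (f (z θ)) = F (z θ) := hfF (hzb θ)
    have h2 : Complex.exp (g (z θ)⁻¹) = H (z θ)⁻¹ := hgH trivial
    have h3 := h (z θ) (hzb θ) (hz0 θ)
    have h4 : Complex.exp (((b : ℂ) - n) * (θ * Complex.I)) =
        Complex.exp (θ * Complex.I) ^ b / Complex.exp (θ * Complex.I) ^ n := by
      rw [sub_mul, Complex.exp_sub, Complex.exp_nat_mul, Complex.exp_nat_mul]
    have he := Complex.exp_ne_zero (θ * Complex.I)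
    have hHz := hH0 (z θ)⁻¹
    rw [hφ]
    simp only []
    rw [Complex.exp_add, Complex.exp_sub, h1, h2, h4, div_mul_div_comm,
      div_eq_div_iff (mul_ne_zero hHz (pow_ne_zero _ he)) (pow_ne_zero _ hr0)]
    simp only [hz, mul_pow] at h3 ⊢
    linear_combination h3
  have hper := eq_of_exp_comp_eq_const hφc hexp (2 * Real.pi) 0
  have hz2 : z (2 * Real.pi) = z 0 := by simp [hz, Complex.exp_two_pi_mul_I]
  simp only [hφ, hz2] at hper
  have : ((b : ℂ) - n) * (2 * Real.pi * Complex.I) = 0 := by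
    push_cast at hper
    linear_combination hper
  rcases mul_eq_zero.1 this with h | h
  · exact_mod_cast sub_eq_zero.1 h
  · exact absurd h Complex.two_pi_I_ne_zero

theorem exists_ball_eval_ne_zero {T : ℂ[X]} (hT : T.eval 0 ≠ 0) :
    ∃ ρ > 0, ∀ w ∈ Metric.ball (0 : ℂ) ρ, T.eval w ≠ 0 :=
  Metric.eventually_nhds_iff_ball.1 (T.continuous.continuousAt.eventually_ne hT)

/-- A section of a line bundle of degree `b` on the projective line, given by the polynomial `P` in
one chart and `Q` in the other one, has degree at most `b`. -/
theorem natDegree_le_of_clutching {P Q : ℂ[X]} (hP : P ≠ 0) {h₀ h₁ : ℂ → ℂ}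
    (hc₀ : Continuous h₀) (hc₁ : Continuous h₁) (hn₀ : ∀ s, h₀ s ≠ 0) (hn₁ : ∀ s, h₁ s ≠ 0) {b : ℕ}
    (h : ∀ s, s ≠ 0 → P.eval s * h₁ s⁻¹ = s ^ b * h₀ s * Q.eval s⁻¹) : P.natDegree ≤ b := by
  have hQ : Q ≠ 0 := by
    rintro rfl
    refine hP (Polynomial.eq_zero_of_infinite_isRoot P
      ((Set.finite_singleton (0 : ℂ)).infinite_compl.mono fun s hs => ?_))
    have := h s hs
    simpa [hn₁] using this
  obtain ⟨T, hT⟩ : X ^ Q.rootMultiplicity 0 ∣ Q := by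
    simpa using Q.pow_rootMultiplicity_dvd 0
  have hT0 : T.eval 0 ≠ 0 := by
    intro h0
    obtain ⟨T', rfl⟩ := Polynomial.dvd_iff_isRoot.2 h0
    have hd : (X - C 0) ^ (Q.rootMultiplicity 0 + 1) ∣ Q := ⟨T', by
      conv_lhs => rw [hT]
      simp only [map_zero, sub_zero]
      ring⟩
    have := (Polynomial.le_rootMultiplicity_iff hQ).2 hd
    omega
  have hR0 : P.reverse.eval 0 ≠ 0 := by
    rw [← Polynomial.coeff_zero_eq_eval_zero, Polynomial.coeff_zero_reverse]
    exact Polynomial.leadingCoeff_ne_zero.2 hP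
  obtain ⟨ρ₁, hρ₁, hb₁⟩ := exists_ball_eval_ne_zero hT0
  obtain ⟨ρ₂, hρ₂, hb₂⟩ := exists_ball_eval_ne_zero hR0
  have hs₁ : Metric.ball (0 : ℂ) (min ρ₁ ρ₂) ⊆ Metric.ball 0 ρ₁ :=
    Metric.ball_subset_ball (min_le_left _ _)
  have hs₂ : Metric.ball (0 : ℂ) (min ρ₁ ρ₂) ⊆ Metric.ball 0 ρ₂ :=
    Metric.ball_subset_ball (min_le_right _ _)
  -- In the coordinate `w = s⁻¹` at infinity, `P` becomes `w ^ (-deg P)` times its reverse and `Q`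
  -- is `w ^ m * T`, where neither the reverse nor `T` vanishes at `0`. Hence `b = deg P + m`, with
  -- `m` the order of the zero at infinity.
  have key := eq_of_clutching (F := fun w => P.reverse.eval w * h₁ w / T.eval w) (H := h₀)
    (b := b) (n := P.natDegree + Q.rootMultiplicity 0) (lt_min hρ₁ hρ₂)
    ((P.reverse.continuous.mul hc₁).continuousOn.div T.continuous.continuousOn
      fun w hw => hb₁ w (hs₁ hw))
    (fun w hw => div_ne_zero (mul_ne_zero (hb₂ w (hs₂ hw)) (hn₁ w)) (hb₁ w (hs₁ hw)))
    hc₀ hn₀ (by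
      intro w hw hw0
      have h1 := h w⁻¹ (inv_ne_zero hw0)
      have h2 : P.eval w⁻¹ * w ^ P.natDegree = P.reverse.eval w := by
        let _ : Invertible w⁻¹ := invertibleOfNonzero (inv_ne_zero hw0)
        have := Polynomial.eval₂_reverse_mul_pow (RingHom.id ℂ) w⁻¹ P
        simp only [Polynomial.eval₂_id, invOf_eq_inv, inv_inv, inv_pow] at this
        rw [← this]
        field_simp
      have h3 : Q.eval w = w ^ Q.rootMultiplicity 0 * T.eval w := by
        conv_lhs => rw [hT]
        simp
      have hT' := hb₁ w (hs₁ hw)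
      rw [inv_inv, h3, inv_pow] at h1
      rw [← h2]
      field_simp
      field_simp at h1
      rw [pow_add]
      linear_combination w ^ P.natDegree * h1)
  omega

/-! ### Restriction of polynomials to vertical lines -/

/-- The restriction of a polynomial in two variables to the line `{t} × ℂ`. -/
noncomputable def restrictLine (t : ℂ) : MvPolynomial (Fin 2) ℂ →ₐ[ℂ] ℂ[X] :=
  MvPolynomial.aeval ![C t, X]

theorem eval_restrictLine (t s : ℂ) (f : MvPolynomial (Fin 2) ℂ) :
    (restrictLine t f).eval s = MvPolynomial.eval ![t, s] f := by
  have : (Polynomial.evalRingHom s).comp (restrictLine t).toRingHom =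
      MvPolynomial.eval ![t, s] := by
    ext k
    · simp
    · fin_cases k <;> simp [restrictLine]
  exact congr($this f)

/-- The coefficients of the restriction to `{t} × ℂ` are polynomials in `t`. -/
theorem exists_coeff_restrictLine (f : MvPolynomial (Fin 2) ℂ) (m : ℕ) :
    ∃ q : ℂ[X], ∀ t, (restrictLine t f).coeff m = q.eval t := by
  refine ⟨(MvPolynomial.aeval (R := ℂ) ![C X, (X : ℂ[X][X])] f).coeff m, fun t => ?_⟩
  have : (Polynomial.mapRingHom (Polynomial.evalRingHom t)).comp
      (MvPolynomial.aeval (R := ℂ) ![C X, (X : ℂ[X][X])]).toRingHom =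
        (restrictLine t).toRingHom := by
    apply MvPolynomial.ringHom_ext
    · intro r
      simp [restrictLine, Polynomial.algebraMap_apply]
    · intro k
      fin_cases k <;> simp [restrictLine]
  have h := congr(($this f).coeff m)
  simp only [RingHom.comp_apply, Polynomial.coe_mapRingHom, Polynomial.coeff_map] at h
  exact h.symm

/-- Restriction to the line sends the maximal ideal of `p` into `(X - p 1)`, hence its `n`-th power
into `((X - p 1) ^ n)`. -/
theorem le_natDegree_restrictLine_of_mem_pow {p : Fin 2 → ℂ} {n : ℕ} {f : MvPolynomial (Fin 2) ℂ}
    (hf : f ∈ MvPolynomial.vanishingIdeal ℂ {p} ^ n) (h0 : restrictLine (p 0) f ≠ 0) :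
    n ≤ (restrictLine (p 0) f).natDegree := by
  have hp : ![p 0, p 1] = p := by ext k; fin_cases k <;> rfl
  have hle : (MvPolynomial.vanishingIdeal ℂ {p}).map (restrictLine (p 0)) ≤
      Ideal.span {X - C (p 1)} := by
    rw [Ideal.map_le_iff_le_comap]
    intro g hg
    rw [Ideal.mem_comap, Ideal.mem_span_singleton, Polynomial.dvd_iff_isRoot,
      Polynomial.IsRoot.def, eval_restrictLine, hp]
    simpa [MvPolynomial.aeval_eq_eval] using hg p rfl
  have h1 : restrictLine (p 0) f ∈ Ideal.span {X - C (p 1)} ^ n := by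
    refine Ideal.pow_right_mono hle n ?_
    rw [← Ideal.map_pow]
    exact Ideal.mem_map_of_mem _ hf
  rw [Ideal.span_singleton_pow, Ideal.mem_span_singleton] at h1
  simpa using Polynomial.natDegree_le_of_dvd h1 h0

/-! ### The Zariski topology of the affine plane -/

/-- The Zariski topology of the affine plane. -/
@[reducible]
noncomputable def affineZariski : TopologicalSpace (Fin 2 → ℂ) :=
  TopologicalSpace.induced (MvPolynomial.pointToPoint (k := ℂ)) inferInstance

theorem isClosed_affineZariski_iff {Z : Set (Fin 2 → ℂ)} :
    IsClosed[affineZariski] Z ↔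
      ∃ S : Set (MvPolynomial (Fin 2) ℂ), Z = {p | ∀ f ∈ S, MvPolynomial.eval p f = 0} := by
  have key : ∀ S : Set (MvPolynomial (Fin 2) ℂ),
      MvPolynomial.pointToPoint (k := ℂ) ⁻¹' PrimeSpectrum.zeroLocus S =
        {p : Fin 2 → ℂ | ∀ f ∈ S, MvPolynomial.eval p f = 0} := by
    intro S
    ext p
    simp only [Set.mem_preimage, PrimeSpectrum.mem_zeroLocus, Set.mem_ofPred_eq]
    refine forall₂_congr fun f _ => ?_
    exact MvPolynomial.mem_vanishingIdeal_singleton_iff p f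
  rw [isClosed_induced_iff]
  constructor
  · rintro ⟨T, hT, rfl⟩
    obtain ⟨S, rfl⟩ := (PrimeSpectrum.isClosed_iff_zeroLocus T).1 hT
    exact ⟨S, key S⟩
  · rintro ⟨S, rfl⟩
    exact ⟨_, PrimeSpectrum.isClosed_zeroLocus S, key S⟩

theorem exists_mem_vanishingIdeal_of_notMem {Z : Set (Fin 2 → ℂ)} (hZ : IsClosed[affineZariski] Z)
    {p : Fin 2 → ℂ} (hp : p ∉ Z) :
    ∃ f ∈ MvPolynomial.vanishingIdeal ℂ Z, MvPolynomial.eval p f ≠ 0 := by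
  obtain ⟨S, rfl⟩ := isClosed_affineZariski_iff.1 hZ
  simp only [Set.mem_ofPred_eq, not_forall] at hp
  obtain ⟨f, hf, hfp⟩ := hp
  exact ⟨f, fun q hq => hq f hf, hfp⟩

theorem isClosed_affineZariski_line (t : ℂ) : IsClosed[affineZariski] {p | p 0 = t} :=
  isClosed_affineZariski_iff.2
    ⟨{MvPolynomial.X 0 - MvPolynomial.C t}, by ext p; simp [sub_eq_zero]⟩

theorem isClosed_affineZariski_singleton (p : Fin 2 → ℂ) : IsClosed[affineZariski] {p} :=
  isClosed_affineZariski_iff.2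
    ⟨{MvPolynomial.X 0 - MvPolynomial.C (p 0), MvPolynomial.X 1 - MvPolynomial.C (p 1)}, by
      ext q
      simp [sub_eq_zero, funext_iff, Fin.forall_fin_two]⟩

/-- A nonempty open subset of the line contains the non-roots of a nonzero polynomial in one
variable, and the product of two such polynomials is nonzero. -/
theorem isIrreducible_affineZariski_line (t : ℂ) :
    @IsIrreducible _ affineZariski {p | p 0 = t} := by
  let _ : TopologicalSpace (Fin 2 → ℂ) := affineZariski
  refine ⟨⟨![t, 0], rfl⟩, ?_⟩
  have key : ∀ u : Set (Fin 2 → ℂ), IsOpen[affineZariski] u → ({p | p 0 = t} ∩ u).Nonempty →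
      ∃ P : ℂ[X], P ≠ 0 ∧ ∀ s, P.eval s ≠ 0 → ![t, s] ∈ u := by
    rintro u hu ⟨p, hp, hpu⟩
    obtain ⟨f, hf, hfp⟩ := exists_mem_vanishingIdeal_of_notMem (Z := uᶜ)
      (@IsOpen.isClosed_compl _ affineZariski _ hu) (p := p) (by simpa using hpu)
    have hpe : ![t, p 1] = p := by
      ext k; fin_cases k
      · exact hp.symm
      · rfl
    refine ⟨restrictLine t f, fun h0 => hfp ?_, fun s hs => ?_⟩
    · rw [← hpe, ← eval_restrictLine, h0, Polynomial.eval_zero]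
    · by_contra hsu
      exact hs (by rw [eval_restrictLine]; exact hf _ hsu)
  intro u v hu hv hu' hv'
  obtain ⟨P, hP, hPu⟩ := key u hu hu'
  obtain ⟨Q, hQ, hQv⟩ := key v hv hv'
  obtain ⟨s, hs⟩ : ∃ s, (P * Q).eval s ≠ 0 := by
    by_contra! h
    exact mul_ne_zero hP hQ (Polynomial.funext (by simpa using h))
  rw [Polynomial.eval_mul] at hs
  exact ⟨![t, s], rfl, hPu s (left_ne_zero_of_mul hs), hQv s (right_ne_zero_of_mul hs)⟩

/-! ### The charts -/

theorem continuous_affineVec (j : Fin 2) : Continuous (affineVec j) := by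
  refine Continuous.subtype_mk ?_ _
  exact Continuous.update (continuous_pi fun _ => continuous_id) j continuous_const

theorem continuous_chart (e : ℕ) (i : Fin 2 × Fin 2) : Continuous (chart e i) := by
  refine continuous_quotient_mk'.comp (Continuous.prodMk ?_ ?_)
  · exact (continuous_affineVec _).comp (continuous_apply 0)
  · exact (continuous_affineVec _).comp (continuous_apply 1)

theorem chart_zero_eq_chart_one (e : ℕ) (i : Fin 2) (t : ℂ) {s : ℂ} (hs : s ≠ 0) :
    chart e (i, 0) ![t, s] = chart e (i, 1) ![t, s⁻¹] := by
  refine Quotient.sound ⟨1, Units.mk0 s⁻¹ (inv_ne_zero hs), ?_, ?_, ?_⟩ <;>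
    simp [affineVec, hs]

theorem proj_chart_eq_iff {e : ℕ} {i : Fin 2} {j j' : Fin 2} {p q : Fin 2 → ℂ} :
    proj e (chart e (i, j) p) = proj e (chart e (i, j') q) ↔ p 0 = q 0 := by
  have h : ∀ (j : Fin 2) (p : Fin 2 → ℂ), proj e (chart e (i, j) p) =
      Projectivization.mk ℂ (affineVec i (p 0)).1 (affineVec i (p 0)).2 := fun _ _ => rfl
  rw [h, h]
  constructor
  · intro hpq
    obtain ⟨a, ha⟩ := (Projectivization.mk_eq_mk_iff ℂ _ _ _ _).1 hpq
    have h0 := congrFun ha 0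
    have h1 := congrFun ha 1
    fin_cases i <;> simp [affineVec, Units.smul_def] at h0 h1
    · simp [← h1, h0]
    · simp [← h0, h1]
  · intro hpq
    simp only [hpq]

theorem chart_injective (e : ℕ) (i : Fin 2 × Fin 2) : Function.Injective (chart e i) := by
  obtain ⟨i, j⟩ := i
  intro p q hpq
  have h0 : p 0 = q 0 := proj_chart_eq_iff.1 (congrArg (proj e) hpq)
  obtain ⟨c, d, h1, h2, h3⟩ := Quotient.exact hpq
  have hc : (c : ℂ) = 1 := by
    have := h1 i
    simpa [affineVec] using this.symm
  have hc' : c = 1 := Units.ext hc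
  subst hc'
  ext k
  fin_cases k
  · exact h0
  · fin_cases j <;> simp [affineVec] at h2 h3 ⊢
    · simpa [← h2] using h3.symm
    · simpa [← h3] using h2.symm

theorem chart_mem_specialSection_iff {e : ℕ} {i j : Fin 2} {p : Fin 2 → ℂ} :
    chart e (i, j) p ∈ specialSection e ↔ (affineVec j (p 1)).1 1 = 0 := by
  constructor
  · rintro ⟨z, hz, h⟩
    obtain ⟨c, d, -, -, h3⟩ := Quotient.exact h
    change (affineVec j (p 1)).1 1 = _ at h3
    rw [h3, hz, mul_zero]
  · intro h
    exact ⟨_, h, rfl⟩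

/-! ### The Zariski topology of the surface -/

theorem isClosed_zariski_iff {e : ℕ} {Z : Set (Surface e)} :
    IsClosed[zariski e] Z ↔ ∀ i, IsClosed[affineZariski] (chart e i ⁻¹' Z) := by
  rw [zariski, isClosed_iSup_iff]
  exact forall_congr' fun i => isClosed_coinduced

theorem continuous_chart_zariski (e : ℕ) (i : Fin 2 × Fin 2) :
    @Continuous _ _ affineZariski (zariski e) (chart e i) := by
  refine (@continuous_iff_isClosed _ _ affineZariski (zariski e) _).2 fun Z hZ => ?_
  exact isClosed_zariski_iff.1 hZ i

theorem isClosed_zariski_singleton {e : ℕ} (x : Surface e) : IsClosed[zariski e] {x} := by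
  refine isClosed_zariski_iff.2 fun i => ?_
  rcases (chart e i ⁻¹' {x}).eq_empty_or_nonempty with h | ⟨p, hp⟩
  · rw [h]
    exact @isClosed_empty _ affineZariski
  · have : chart e i ⁻¹' {x} = {p} := by
      ext q
      refine ⟨fun hq => chart_injective e i (hq.trans hp.symm), ?_⟩
      rintro rfl
      exact hp
    rw [this]
    exact isClosed_affineZariski_singleton p

theorem isClosed_zariski_fibre {e : ℕ} (ℓ : ℙ ℂ (Fin 2 → ℂ)) : IsClosed[zariski e] (fibre e ℓ) := by
  refine isClosed_zariski_iff.2 fun i => ?_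
  rcases (chart e i ⁻¹' fibre e ℓ).eq_empty_or_nonempty with h | ⟨p, hp⟩
  · rw [h]
    exact @isClosed_empty _ affineZariski
  · have : chart e i ⁻¹' fibre e ℓ = {q | q 0 = p 0} := by
      ext q
      rw [← (show proj e (chart e i p) = ℓ from hp)]
      exact proj_chart_eq_iff (i := i.1) (j := i.2) (j' := i.2)
    rw [this]
    exact isClosed_affineZariski_line _

/-- The closure of the image is irreducible and strictly contains the closed point `φ a`. In
dimension at most one it is therefore maximal, that is, all of `C`. -/
theorem subset_closure_range_of_topologicalKrullDim_le_one {X A : Type*} [TopologicalSpace X]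
    [TopologicalSpace A] [IrreducibleSpace A] {C : Set X} (hC : IsIrreducible C)
    (hdim : topologicalKrullDim C ≤ 1) {φ : A → X} (hφ : Continuous φ) (hφC : ∀ a, φ a ∈ C)
    {a a' : A} (hne : φ a ≠ φ a') (hcl : IsClosed {φ a}) : C ⊆ closure (Set.range φ) := by
  have : IrreducibleSpace C := Subtype.irreducibleSpace hC
  let ψ : A → C := fun a => ⟨φ a, hφC a⟩
  have hψ : Continuous ψ := hφ.subtype_mk _
  let Z : TopologicalSpace.IrreducibleCloseds C :=
    ⟨closure (ψ '' Set.univ), ((IrreducibleSpace.isIrreducible_univ A).image ψ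
      hψ.continuousOn).closure, isClosed_closure⟩
  have hmem : ∀ a, ψ a ∈ closure (ψ '' Set.univ) := fun a =>
    subset_closure (Set.mem_image_of_mem _ trivial)
  rcases Order.krullDim_le_one_iff.1 hdim Z with hmin | hmax
  · have hcl' : IsClosed ({ψ a} : Set C) := by
      have : ({ψ a} : Set C) = Subtype.val ⁻¹' {φ a} := by
        ext x
        simp [ψ, Subtype.ext_iff]
      rw [this]
      exact hcl.preimage continuous_subtype_val
    have hle := hmin (b := ⟨{ψ a}, isIrreducible_singleton, hcl'⟩) (by
      rintro x rfl
      exact hmem a)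
    exact absurd (congrArg Subtype.val (show ψ a' = ψ a from hle (hmem a'))).symm hne
  · have hle := hmax (b := ⟨Set.univ, IrreducibleSpace.isIrreducible_univ C, isClosed_univ⟩)
      (fun _ _ => trivial)
    intro x hx
    have h1 : (⟨x, hx⟩ : C) ∈ closure (ψ '' Set.univ) := hle (Set.mem_univ _)
    have h2 := closure_subtype.1 h1
    rwa [Set.image_univ, ← Set.range_comp] at h2

/-- An irreducible curve that contains the points of a fibre in a chart is a fibre. -/
theorem subset_fibre_of_line_subset {e : ℕ} {C : Set (Surface e)} (hC : IsIrreducibleCurve C)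
    {i : Fin 2 × Fin 2} {p : Fin 2 → ℂ} (h : ∀ q, q 0 = p 0 → chart e i q ∈ C) :
    C ⊆ fibre e (proj e (chart e i p)) := by
  let _ : TopologicalSpace (Surface e) := zariski e
  let _ : TopologicalSpace (Fin 2 → ℂ) := affineZariski
  have : IrreducibleSpace {q : Fin 2 → ℂ | q 0 = p 0} :=
    Subtype.irreducibleSpace (isIrreducible_affineZariski_line (p 0))
  refine (subset_closure_range_of_topologicalKrullDim_le_one hC.2.1 hC.2.2.le
    (A := {q : Fin 2 → ℂ | q 0 = p 0}) (φ := fun q => chart e i q)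
    ((continuous_chart_zariski e i).comp continuous_subtype_val) (fun q => h q q.2)
    (a := ⟨![p 0, 0], rfl⟩) (a' := ⟨![p 0, 1], rfl⟩) (fun h01 => ?_)
    (isClosed_zariski_singleton _)).trans (closure_minimal ?_ (isClosed_zariski_fibre _))
  · simpa using congrFun (chart_injective e i h01) 1
  · rintro _ ⟨q, rfl⟩
    exact (proj_chart_eq_iff (i := i.1) (j := i.2) (j' := i.2)).2 q.2

/-- A fibre is smooth. -/
theorem not_isSingularPoint_of_subset_fibre {e : ℕ} {C : Set (Surface e)} {x : Surface e}
    (h : C ⊆ fibre e (proj e x)) : ¬ IsSingularPoint C x := by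
  rintro ⟨-, i, p, rfl, hp⟩
  -- This equation of the fibre vanishes on `C`, and its derivative in the base coordinate is `1`.
  have := hp (MvPolynomial.X 0 - MvPolynomial.C (p 0)) (fun q hq => by
    have : q 0 = p 0 := (proj_chart_eq_iff (i := i.1) (j := i.2) (j' := i.2)).1 (h hq)
    simp [this]) 0
  simp at this

/-! ### The degree on a fibre -/

/-- As `C` is closed, some element of its ideal is nonzero at `p`, and that element is a multiple of
`f`. -/
theorem eval_ne_zero_of_chartIdeal_eq_span {e : ℕ} {C : Set (Surface e)}
    (hC : IsClosed[zariski e] C) {i : Fin 2 × Fin 2} {f : MvPolynomial (Fin 2) ℂ}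
    (hf : chartIdeal C i = Ideal.span {f}) {p : Fin 2 → ℂ} (hp : chart e i p ∉ C) :
    MvPolynomial.eval p f ≠ 0 := by
  obtain ⟨g, hg, hgp⟩ := exists_mem_vanishingIdeal_of_notMem (isClosed_zariski_iff.1 hC i) hp
  obtain ⟨u, rfl⟩ := Ideal.mem_span_singleton.1 (hf ▸ hg : g ∈ Ideal.span {f})
  rw [map_mul] at hgp
  exact left_ne_zero_of_mul hgp

theorem eval_ne_zero_of_specialSection {e : ℕ} {i : Fin 2} {f : MvPolynomial (Fin 2) ℂ}
    (hf : chartIdeal (specialSection e) (i, 1) = Ideal.span {f}) (p : Fin 2 → ℂ) :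
    MvPolynomial.eval p f ≠ 0 := by
  have h1 : (1 : MvPolynomial (Fin 2) ℂ) ∈ chartIdeal (specialSection e) (i, 1) := by
    intro q hq
    have := chart_mem_specialSection_iff.1 hq
    simp [affineVec] at this
  obtain ⟨u, hu⟩ := Ideal.mem_span_singleton.1 (hf ▸ h1)
  have := congr(MvPolynomial.eval p $hu)
  rw [map_one, map_mul] at this
  exact left_ne_zero_of_mul (this ▸ one_ne_zero)

/-- The generator divides the coordinate `X 1`, which cuts out the section in this chart. On a
vertical line it is thus `s` times a unit: this simple zero is the source of the factor `s ^ b`. -/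
theorem exists_eval_eq_mul_of_specialSection {e : ℕ} {i : Fin 2} {f : MvPolynomial (Fin 2) ℂ}
    (hf : chartIdeal (specialSection e) (i, 0) = Ideal.span {f}) (t : ℂ) :
    ∃ T : ℂ[X], (∀ s, T.eval s ≠ 0) ∧ ∀ s, MvPolynomial.eval ![t, s] f = s * T.eval s := by
  have hmem : ∀ p, chart e (i, 0) p ∈ specialSection e ↔ p 1 = 0 := fun p =>
    chart_mem_specialSection_iff.trans (by simp [affineVec])
  have hX : (MvPolynomial.X 1 : MvPolynomial (Fin 2) ℂ) ∈
      chartIdeal (specialSection e) (i, 0) := by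
    intro q hq
    simpa using (hmem q).1 hq
  have h0 : (restrictLine t f).IsRoot 0 := by
    have : f ∈ chartIdeal (specialSection e) (i, 0) := hf ▸ Ideal.mem_span_singleton_self f
    rw [Polynomial.IsRoot.def, eval_restrictLine]
    exact this _ ((hmem _).2 rfl)
  obtain ⟨T, hT⟩ := Polynomial.dvd_iff_isRoot.2 h0
  rw [map_zero, sub_zero] at hT
  obtain ⟨u, hu⟩ := Ideal.mem_span_singleton.1 (hf ▸ hX)
  refine ⟨T, fun s => ?_, fun s => ?_⟩
  · have h1 : X * (T * restrictLine t u) = X * (1 : ℂ[X]) := by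
      have := congr(restrictLine t $hu)
      rw [map_mul, hT] at this
      rw [← mul_assoc, ← this, restrictLine]
      simp
    have := congr(Polynomial.eval s $(mul_left_cancel₀ X_ne_zero h1))
    rw [Polynomial.eval_mul, Polynomial.eval_one] at this
    exact left_ne_zero_of_mul (this ▸ one_ne_zero)
  · rw [← eval_restrictLine, hT]
    simp

/-- The restrictions to a fibre of the local equations of a curve of type `(a, b)` are related by
a clutching function of degree `b`. -/
theorem exists_clutching {e a b : ℕ} {ℓ : ℙ ℂ (Fin 2 → ℂ)}
    {f fL fM : Fin 2 × Fin 2 → MvPolynomial (Fin 2) ℂ} {g gL gM : cocycles e}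
    (hfg : ∀ i j p q, ∀ h : chart e i p = chart e j q, MvPolynomial.eval p (f i) =
      (g.1 i j ⟨chart e i p, ⟨p, rfl⟩, ⟨q, h.symm⟩⟩ : ℂˣ) * MvPolynomial.eval q (f j))
    (hL : ∀ i, chartIdeal (fibre e ℓ) i = Ideal.span {fL i})
    (hfgL : ∀ i j p q, ∀ h : chart e i p = chart e j q, MvPolynomial.eval p (fL i) =
      (gL.1 i j ⟨chart e i p, ⟨p, rfl⟩, ⟨q, h.symm⟩⟩ : ℂˣ) * MvPolynomial.eval q (fL j))
    (hM : ∀ i, chartIdeal (specialSection e) i = Ideal.span {fM i})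
    (hfgM : ∀ i j p q, ∀ h : chart e i p = chart e j q, MvPolynomial.eval p (fM i) =
      (gM.1 i j ⟨chart e i p, ⟨p, rfl⟩, ⟨q, h.symm⟩⟩ : ℂˣ) * MvPolynomial.eval q (fM j))
    (hγ : (Additive.ofMul (QuotientGroup.mk g) : H2 e) =
      a • Additive.ofMul (QuotientGroup.mk gL) + b • (e • Additive.ofMul (QuotientGroup.mk gL) +
        Additive.ofMul (QuotientGroup.mk gM)))
    {i : Fin 2} {t : ℂ} (ht : proj e (chart e (i, 0) ![t, 0]) ≠ ℓ) :
    ∃ h₀ h₁ : ℂ → ℂ, Continuous h₀ ∧ Continuous h₁ ∧ (∀ s, h₀ s ≠ 0) ∧ (∀ s, h₁ s ≠ 0) ∧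
      ∀ s, s ≠ 0 → (restrictLine t (f (i, 0))).eval s * h₁ s⁻¹ =
        s ^ b * h₀ s * (restrictLine t (f (i, 1))).eval s⁻¹ := by
  have hγ' : (QuotientGroup.mk g : cocycles e ⧸ (differential e).range) =
      QuotientGroup.mk (gL ^ a * (gL ^ e * gM) ^ b) := by
    have := congrArg Additive.toMul hγ
    simpa using this
  obtain ⟨h, hh⟩ := QuotientGroup.eq.1 hγ'
  obtain ⟨T, hT0, hT⟩ := exists_eval_eq_mul_of_specialSection (hM (i, 0)) t
  have hL0 : ∀ (j : Fin 2) (s : ℂ), (restrictLine t (fL (i, j))).eval s ≠ 0 := by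
    intro j s
    rw [eval_restrictLine]
    refine eval_ne_zero_of_chartIdeal_eq_span (isClosed_zariski_fibre ℓ) (hL (i, j)) fun hmem => ?_
    refine ht (Eq.trans ?_ hmem)
    exact proj_chart_eq_iff.2 rfl
  have hM0 : ∀ s : ℂ, (restrictLine t (fM (i, 1))).eval s ≠ 0 := fun s => by
    rw [eval_restrictLine]
    exact eval_ne_zero_of_specialSection (hM (i, 1)) _
  have hline : Continuous fun s : ℂ => (![t, s] : Fin 2 → ℂ) := by
    refine continuous_pi fun k => ?_
    fin_cases k
    · exact continuous_const
    · exact continuous_id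
  have hhc : ∀ j : Fin 2, Continuous fun s : ℂ =>
      ((h (i, j) ⟨chart e (i, j) ![t, s], ⟨_, rfl⟩⟩ : ℂˣ) : ℂ) := fun j =>
    Units.continuous_val.comp ((h (i, j)).continuous.comp
      (((continuous_chart e (i, j)).comp hline).subtype_mk _))
  -- The product of equations prescribed by `a L + b (e L + M₀)`, corrected by the cochain `h` that
  -- relates the two cocycles. In the first chart the factor `s ^ b` of `fM ^ b` is split off,
  -- leaving `T ^ b`.
  refine ⟨fun s => (restrictLine t (fL (i, 0))).eval s ^ (a + e * b) * T.eval s ^ b /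
      (h (i, 0) ⟨chart e (i, 0) ![t, s], ⟨_, rfl⟩⟩ : ℂˣ),
    fun s => (restrictLine t (fL (i, 1))).eval s ^ (a + e * b) *
      (restrictLine t (fM (i, 1))).eval s ^ b /
        (h (i, 1) ⟨chart e (i, 1) ![t, s], ⟨_, rfl⟩⟩ : ℂˣ), ?_, ?_, ?_, ?_, ?_⟩
  · exact (((Polynomial.continuous _).pow _).mul (T.continuous.pow _)).div (hhc 0)
      fun s => Units.ne_zero _
  · exact (((Polynomial.continuous _).pow _).mul ((Polynomial.continuous _).pow _)).div (hhc 1)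
      fun s => Units.ne_zero _
  · exact fun s => div_ne_zero (mul_ne_zero (pow_ne_zero _ (hL0 0 s)) (pow_ne_zero _ (hT0 s)))
      (Units.ne_zero _)
  · exact fun s => div_ne_zero (mul_ne_zero (pow_ne_zero _ (hL0 1 s)) (pow_ne_zero _ (hM0 s)))
      (Units.ne_zero _)
  · intro s hs
    have hx := chart_zero_eq_chart_one e i t hs
    have eC := hfg _ _ _ _ hx
    have eL := hfgL _ _ _ _ hx
    have eM := hfgM _ _ _ _ hx
    rw [hT] at eM
    set x : (U e (i, 0) ∩ U e (i, 1) : Set (Surface e)) :=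
      ⟨chart e (i, 0) ![t, s], ⟨_, rfl⟩, ⟨_, hx.symm⟩⟩ with hxdef
    have hd : h (i, 0) ⟨chart e (i, 0) ![t, s], ⟨_, rfl⟩⟩ /
        h (i, 1) ⟨chart e (i, 1) ![t, s⁻¹], ⟨_, rfl⟩⟩ =
          (g.1 (i, 0) (i, 1) x)⁻¹ * (gL.1 (i, 0) (i, 1) x ^ a *
            (gL.1 (i, 0) (i, 1) x ^ e * gM.1 (i, 0) (i, 1) x) ^ b) := by
      have h1 := congr(($hh).1 (i, 0) (i, 1) x)
      refine Eq.trans ?_ h1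
      have : (⟨chart e (i, 1) ![t, s⁻¹], ⟨_, rfl⟩⟩ : U e (i, 1)) =
        ⟨chart e (i, 0) ![t, s], ⟨_, hx.symm⟩⟩ := Subtype.ext hx.symm
      rw [this]
      rfl
    simp only [eval_restrictLine]
    rw [div_eq_iff_eq_mul] at hd
    have hd' := congr((g.1 (i, 0) (i, 1) x : ℂ) * (($hd : ℂˣ) : ℂ))
    push_cast at hd'
    set u := (g.1 (i, 0) (i, 1) x : ℂ)
    set v := (gL.1 (i, 0) (i, 1) x : ℂ)
    set w := (gM.1 (i, 0) (i, 1) x : ℂ)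
    have hu : u ≠ 0 := Units.ne_zero _
    set H₀ := ((h (i, 0) ⟨chart e (i, 0) ![t, s], ⟨_, rfl⟩⟩ : ℂˣ) : ℂ)
    set H₁ := ((h (i, 1) ⟨chart e (i, 1) ![t, s⁻¹], ⟨_, rfl⟩⟩ : ℂˣ) : ℂ)
    have hH₀ : H₀ ≠ 0 := Units.ne_zero _
    have hH₁ : H₁ ≠ 0 := Units.ne_zero _
    rw [eC, eL]
    generalize MvPolynomial.eval ![t, s⁻¹] (f (i, 1)) = q at *
    generalize MvPolynomial.eval ![t, s⁻¹] (fL (i, 1)) = lam at *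
    generalize MvPolynomial.eval ![t, s⁻¹] (fM (i, 1)) = μ at *
    have hdmul : u * H₀ = v ^ (a + e * b) * w ^ b * H₁ := by
      rw [hd', pow_add, pow_mul, mul_pow]
      field_simp
    have eMpow : s ^ b * T.eval s ^ b = w ^ b * μ ^ b := by rw [← mul_pow, eM, mul_pow]
    rw [mul_div_assoc', mul_div_assoc', div_mul_eq_mul_div, div_eq_div_iff hH₁ hH₀, mul_pow]
    linear_combination q * lam ^ (a + e * b) * μ ^ b * hdmul -
      v ^ (a + e * b) * lam ^ (a + e * b) * q * H₁ * eMpow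

/-- A curve of type `(a, b)` has local equations of degree at most `b` along each fibre. -/
theorem exists_natDegree_restrictLine_le {e a b : ℕ} {C : Set (Surface e)} (hC : IsOfType C a b) :
    ∃ f : Fin 2 × Fin 2 → MvPolynomial (Fin 2) ℂ, (∀ i, chartIdeal C i = Ideal.span {f i}) ∧
      ∀ i t, (restrictLine t (f i)).natDegree ≤ b := by
  obtain ⟨-, -, ℓ, _, _, _, ⟨f, g, hf, hfg, rfl⟩, ⟨fL, gL, hL, hfgL, rfl⟩,
    ⟨fM, gM, hM, hfgM, rfl⟩, hγ⟩ := hC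
  refine ⟨f, hf, ?_⟩
  rintro ⟨i, j⟩ t
  -- A zero restriction has `natDegree` zero, so the bound says nothing about lines contained in
  -- `C`.
  rcases eq_or_ne (restrictLine t (f (i, j))) 0 with h0 | h0
  · simp [h0]
  -- The leading coefficient at `t` is the value of a nonzero polynomial `q`. A nearby generic `t'`,
  -- not a root of `q` and not over `ℓ`, has restriction of at least the same degree, so it suffices
  -- to bound the degree there.
  obtain ⟨q, hq⟩ := exists_coeff_restrictLine (f (i, j)) (restrictLine t (f (i, j))).natDegree
  have hq0 : q ≠ 0 := by
    rintro rfl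
    exact Polynomial.leadingCoeff_ne_zero.2 h0 (by simpa using hq t)
  have hfin : {t' : ℂ | proj e (chart e (i, 0) ![t', 0]) = ℓ}.Subsingleton := by
    intro t₁ h₁ t₂ h₂
    exact proj_chart_eq_iff.1 (Eq.trans h₁ (Eq.symm h₂))
  obtain ⟨t', ht'⟩ :=
    ((Polynomial.finite_setOfPred_isRoot hq0).union hfin.finite).infinite_compl.nonempty
  simp only [Set.mem_compl_iff, Set.mem_union, not_or] at ht'
  obtain ⟨hroot, hℓ⟩ := ht'
  have hcoeff : (restrictLine t' (f (i, j))).coeff (restrictLine t (f (i, j))).natDegree ≠ 0 := by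
    rw [hq]
    exact hroot
  refine (Polynomial.le_natDegree_of_ne_zero hcoeff).trans ?_
  have hne : restrictLine t' (f (i, j)) ≠ 0 := fun h => hcoeff (by simp [h])
  obtain ⟨h₀, h₁, hc₀, hc₁, hn₀, hn₁, h⟩ := exists_clutching hfg hL hfgL hM hfgM hγ hℓ
  fin_cases j
  · exact natDegree_le_of_clutching hne hc₀ hc₁ hn₀ hn₁ h
  -- The clutching relation is symmetric under `s ↦ s⁻¹` with the two charts exchanged.
  · refine natDegree_le_of_clutching hne hc₁ hc₀ hn₁ hn₀ (Q := restrictLine t' (f (i, 0)))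
      fun s hs => ?_
    have := h s⁻¹ (inv_ne_zero hs)
    rw [inv_inv, inv_pow] at this
    field_simp at this
    rw [one_div] at this
    simp only [Fin.mk_one, Fin.isValue]
    linear_combination -this

end Hirzebruch

theorem mainTheorem5 (e a b : ℕ) (C : Set (Hirzebruch.Surface e))
    (hC : Hirzebruch.IsOfType C a b) (x : Hirzebruch.Surface e)
    (hx : Hirzebruch.IsSingularPoint C x) :
    Hirzebruch.multiplicity C x ≤ (b : ℕ∞) := by
  open Hirzebruch in
  obtain ⟨f, hf, hdeg⟩ := exists_natDegree_restrictLine_le hC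
  refine iSup_le fun i => iSup_le fun p => iSup_le fun hp => iSup_le fun n => iSup_le fun hn => ?_
  have hmem : f i ∈ MvPolynomial.vanishingIdeal ℂ {p} ^ n :=
    hn (hf i ▸ Ideal.mem_span_singleton_self (f i))
  rcases eq_or_ne (restrictLine (p 0) (f i)) 0 with h0 | h0
  -- Here `f i` vanishes on the whole vertical line through `p`, so `C` contains that line.
  · refine absurd hx (not_isSingularPoint_of_subset_fibre ?_)
    rw [← hp]
    refine subset_fibre_of_line_subset hC.2.1 fun q hq => ?_
    by_contra hqC
    refine eval_ne_zero_of_chartIdeal_eq_span hC.2.1.1 (hf i) hqC ?_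
    have hqe : ![p 0, q 1] = q := by
      ext k
      fin_cases k
      · exact hq.symm
      · rfl
    rw [← hqe, ← eval_restrictLine, h0, Polynomial.eval_zero]
  · exact_mod_cast (le_natDegree_restrictLine_of_mem_pow hmem h0).trans (hdeg i (p 0))
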